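/- Let $E$ be a Polish space with its Borel $\sigma$-field, $M_1(E)$ the set of probability measures on $E$, and $\alpha\in M_1(E)$. Let $X_1,X_2,\dots$ be i.i.d. with law $\alpha$ and $L_n=\frac1n\sum_{i=1}^n\delta_{X_i}$. For $\beta,\gamma\in M_1(E)$ let $H(\beta\mid\gamma)\in[0,+\infty]$ be the relative entropy, and for $B\subseteq M_1(E)$ let $H(B\mid\gamma)=\inf_{\beta\in B}H(\beta\mid\gamma)$. For a convex $B\subseteq M_1(E)$ with $H(B\mid\alpha)<+\infty$, the generalized $I$-projection of $\alpha$ on $B$ is the unique probability measure to which every sequence $\nu_m\in B$ with $H(\nu_m\mid\alpha)\to H(B\mid\alpha)$ converges in total variation; if it belongs to $B$ it is called the $I$-projection. Let $G$ be a set of real measurable functions on $E$ that contains all bounded measurable functions and satisfies $\int|g|\,d\alpha<+\infty$ for every $g\in G$. The $G$-topology is the coarsest topology on $\{\nu\in M_1(E):\int|g|\,d\nu<+\infty\ \forall g\in G\}$ for which all the maps $\nu\mapsto\int g\,d\nu$, $g\in G$, are continuous; a subset of $M_1(E)$ is called closed for the $G$-topology if its intersection with this set is closed. Let $(C_n)_{n\ge1}$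 be a non increasing sequence of convex subsets of $M_1(E)$, closed for the $G$-topology, such that the events $\{L_n\in C_n\}$ are measurable, and let $C=\bigcap_{n\ge1}C_n$. Assume that 1. $H(C\mid\alpha)<+\infty$; 2. $\alpha$ has an $I$-projection $\alpha^*$ on $C$; 3. $\lim_{n\to\infty}H(C_n\mid\alpha)=H(C\mid\alpha)$; 4. $\liminf_{n\to\infty}\frac1n\log\alpha^{\otimes n}(L_n\in C_n)\ge -H(C\mid\alpha)$; 5. for some $p>1$, the densities $h_n=\frac{d\alpha_n^*}{d\alpha}$ of the generalized $I$-projections $\alpha_n^*$ of $\alpha$ on $C_n$ form a bounded sequence in $\mathbb L^p(\alpha)$. Let $\tau(u)=e^{|u|}-|u|-1$, let $\mathbb L_\tau(\alpha)$ be the space of measurable $g:E\to\mathbb R$ such that $\int e^{s|g|}\,d\alpha<+\infty$ for some $s>0$, with the Luxemburg norm $\|g\|_\tau=\inf\{s>0:\int\tau(g/s)\,d\alpha\le1\}$, and let $\|\mu-\nu\|_\tau^*=\sup\{|\int g\,d\mu-\int g\,d\nu|:g\in\mathbb L_\tau(\alpha),\ \|g\|_\tau\le1\}$ be the dual norm.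 Let $\alpha^n_{C_n}(B)=\alpha^{\otimes n}(X_1\in B\mid L_n\in C_n)$ be the conditional law of $X_1$, which is well defined for $n$ large enough. Then $$\lim_{n\to\infty}\big\|\alpha^n_{C_n}-\alpha^*\big\|^*_\tau=0 .$$ -/

import Mathlib

open MeasureTheory Filter Topology
open scoped ENNReal NNReal

namespace ThinSets

variable {E : Type*} [MeasurableSpace E]

/-- `H(B ∣ γ) = inf {H(β ∣ γ) : β ∈ B}`, where `H` is the relative entropy
(Mathlib's Kullback-Leibler divergence). The infimum over the empty set is `∞`. -/
noncomputable def entropyInf (B : Set (ProbabilityMeasure E)) (γ : Measure E) : ℝ≥0∞ :=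
  ⨅ β ∈ B, InformationTheory.klDiv (β : Measure E) γ

/-- Total variation distance `sup_A |μ(A) - ν(A)|` between two probability measures
(half of the total variation norm of `μ - ν`). -/
noncomputable def tvDist (μ ν : ProbabilityMeasure E) : ℝ≥0∞ :=
  ⨆ (A : Set E) (_ : MeasurableSet A),
    ENNReal.ofReal |(μ : Measure E).real A - (ν : Measure E).real A|

/-- `β` is the generalized `I`-projection of `α` on `C`: `H(C ∣ α)` is finite and every
minimizing sequence of `C` converges to `β` in total variation. -/
def IsGenIProjection (α : Measure E) (C : Set (ProbabilityMeasure E))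
    (β : ProbabilityMeasure E) : Prop :=
  entropyInf C α < ∞ ∧
    ∀ ν : ℕ → ProbabilityMeasure E, (∀ m, ν m ∈ C) →
      Tendsto (fun m => InformationTheory.klDiv (ν m : Measure E) α) atTop
        (𝓝 (entropyInf C α)) →
      Tendsto (fun m => tvDist (ν m) β) atTop (𝓝 0)

/-- `β` is the `I`-projection of `α` on `C`: the generalized `I`-projection, lying in `C`. -/
def IsIProjection (α : Measure E) (C : Set (ProbabilityMeasure E))
    (β : ProbabilityMeasure E) : Prop :=
  IsGenIProjection α C β ∧ β ∈ C

/-- A set of probability measures is convex as a set of measures. -/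
def IsConvexSet (C : Set (ProbabilityMeasure E)) : Prop :=
  Convex ℝ≥0 ((fun ν : ProbabilityMeasure E => (ν : Measure E)) '' C)

/-- The probability measures that integrate every function of `G`. -/
def IntegratingMeasures (G : Set (E → ℝ)) : Set (ProbabilityMeasure E) :=
  {ν | ∀ g ∈ G, Integrable g (ν : Measure E)}

/-- The `G`-topology: the coarsest topology, on the probability measures integrating every
function of `G`, for which `ν ↦ ∫ g dν` is continuous for every `g ∈ G`. -/
@[reducible] noncomputable def gTopology (G : Set (E → ℝ)) : TopologicalSpace (IntegratingMeasures G) :=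
  TopologicalSpace.induced
    (fun (ν : IntegratingMeasures G) (g : G) => ∫ x, (g : E → ℝ) x ∂(ν.1 : Measure E))
    inferInstance

/-- `C` is closed for the `G`-topology (its trace on the domain of this topology is closed). -/
def IsGClosed (G : Set (E → ℝ)) (C : Set (ProbabilityMeasure E)) : Prop :=
  IsClosed[gTopology G] {ν : IntegratingMeasures G | ν.1 ∈ C}

/-- The empirical measure `(1/n) ∑ δ_{x_i}` of a sample of size `n ≥ 1`. -/
noncomputable def empiricalMeasure (n : ℕ+) (x : Fin n → E) : Measure E :=
  ((n : ℕ) : ℝ≥0∞)⁻¹ • ∑ i, Measure.dirac (x i)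

/-- The event `L_n ∈ A`, as a set of samples. -/
def empiricalEvent (n : ℕ+) (A : Set (ProbabilityMeasure E)) : Set (Fin n → E) :=
  {x | ∃ ν ∈ A, (ν : Measure E) = empiricalMeasure n x}

/-- The law `α^{⊗n}` of an i.i.d. sample of size `n`. -/
noncomputable def sampleLaw (α : Measure E) (n : ℕ+) : Measure (Fin n → E) :=
  Measure.pi fun _ => α

/-- The conditional law `B ↦ α^{⊗n}(X_1 ∈ B ∣ L_n ∈ A)` of the first observation
(the zero measure if the conditioning event is null). -/
noncomputable def conditionalLaw (α : Measure E) (n : ℕ+) (A : Set (ProbabilityMeasure E)) :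
    Measure E :=
  (ProbabilityTheory.cond (sampleLaw α n) (empiricalEvent n A)).map (fun x => x 0)

/-- The Young function `τ(u) = e^{|u|} - |u| - 1`. -/
noncomputable def tau (u : ℝ) : ℝ := Real.exp |u| - |u| - 1

/-- The Orlicz space `L_τ(α)` of measurable functions with some exponential moment. -/
def orliczSpace (α : Measure E) : Set (E → ℝ) :=
  {g | Measurable g ∧ ∃ s : ℝ, 0 < s ∧ ∫⁻ x, ENNReal.ofReal (Real.exp (s * |g x|)) ∂α < ∞}

/-- The Luxemburg norm `‖g‖_τ = inf {s > 0 : ∫ τ(g/s) dα ≤ 1}`. -/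
noncomputable def luxemburgNorm (α : Measure E) (g : E → ℝ) : ℝ≥0∞ :=
  ⨅ (s : ℝ≥0) (_ : 0 < s ∧ ∫⁻ x, ENNReal.ofReal (tau (g x / s)) ∂α ≤ 1), (s : ℝ≥0∞)

open Classical in
/-- The dual norm `‖μ - ν‖_τ^* = sup {|∫ g dμ - ∫ g dν| : g ∈ L_τ(α), ‖g‖_τ ≤ 1}`. It is `∞`
as soon as some such `g` fails to be integrable for `μ` or for `ν`. -/
noncomputable def dualNormSub (α μ ν : Measure E) : ℝ≥0∞ :=
  ⨆ (g : E → ℝ) (_ : g ∈ orliczSpace α ∧ luxemburgNorm α g ≤ 1),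
    if Integrable g μ ∧ Integrable g ν then ENNReal.ofReal |∫ x, g x ∂μ - ∫ x, g x ∂ν| else ∞

end ThinSets

/-!
The argument compares both the conditional law `π_n` of `X_1` given `L_n ∈ C_n` and the
`I`-projection `α*` with the generalized `I`-projection `β_n` of `α` on `C_n`.

Let `P_n` be the probability of the event `L_n ∈ C_n`. The conditioned sample is exchangeable, so
`π_n` is the mean of `L_n` over the event; since `C_n` is convex and closed for the `G`-topology,
`π_n ∈ C_n` (`conditionalLaw_mem`). Superadditivity of the entropy gives
`H(π_n ∣ α) ≤ -(1 / n) log P_n` (`klDiv_conditionalLaw_le`), and the Pythagorean inequality of Csiszár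
(`varEntropyLE_of_isGenIProjection`) then gives `H(π_n ∣ β_n) ≤ -(1 / n) log P_n - H(C_n ∣ α)`. The
upper limit of the right-hand side is at most `0` by the assumptions on `P_n` and on `H(C_n ∣ α)`.
The Pythagorean inequality also gives `H(α* ∣ β_n) ≤ H(C ∣ α) - H(C_n ∣ α)`
(`varEntropyLE_of_isGenIProjection_subset`), which tends to `0`.

A function of the unit ball of `L_τ(α)` has a bounded exponential moment for `α`, hence for `β_n` by
Hölder's inequality, with a bound independent of `n`. Its integrals for two measures whose entropy
with respect to `β_n` is small are therefore uniformly close (`dualNormSub_le`).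

Entropies with respect to `β_n` enter only through the dual inequality
`∫ v dγ + 1 - ∫ e ^ v dβ_n ≤ D` for bounded `v`. It passes to limits directly, and follows from a
convexity gap (`IsMix.klDiv_gap`). The same gap at midpoints shows that minimizing sequences are
Cauchy in total variation, which yields the existence of `β_n` (`exists_isGenIProjection`).
-/

open InformationTheory

namespace ThinSets

/-! ### Densities and the convexity gap of the entropy -/

section

variable {E : Type*} [MeasurableSpace E]

/-- Young's inequality for the entropy `b log (b / h)` and its dual `h (e ^ v - 1)`, with the linear
terms that make both sides vanish at `b = h`, `v = 0`. -/
lemma young_mul_log {b h : ℝ} (hb : 0 ≤ b) (hh : 0 ≤ h) (hbh : h = 0 → b = 0) (v : ℝ) :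
    b * v + b - h * Real.exp v ≤ b * (Real.log b - Real.log h) := by
  rcases hb.eq_or_lt with rfl | hb
  · have := mul_nonneg hh (Real.exp_pos v).le
    simp; linarith
  · have hh : 0 < h := hh.lt_of_ne fun h0 => hb.ne' (hbh h0.symm)
    have key := Real.log_le_sub_one_of_pos (x := h * Real.exp v / b) (by positivity)
    rw [Real.log_div (by positivity) hb.ne', Real.log_mul hh.ne' (Real.exp_pos v).ne',
      Real.log_exp] at key
    have : b * (Real.log h + v - Real.log b) ≤ b * (h * Real.exp v / b - 1) :=
      mul_le_mul_of_nonneg_left key hb.le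
    have e : b * (h * Real.exp v / b - 1) = h * Real.exp v - b := by field_simp
    rw [e] at this
    linarith

/-- Pointwise form of `IsMix.klDiv_gap`: the convexity gap of `klFun` equals
`t b log (b / h) + (1 - t) a log (a / h)`, where `h = (1 - t) a + t b`. Young's inequality is
applied to the first term with `v` and to the second one with `0`; the last term on the
left-hand side has integral zero when `a` and `b` are probability densities. -/
lemma klFun_mix_gap {a b t : ℝ} (ha : 0 ≤ a) (hb : 0 ≤ b) (ht0 : 0 < t) (ht1 : t < 1) (v : ℝ) :
    t * (b * v + b - ((1 - t) * a + t * b) * Real.exp v) + (1 - t) * (t * (a - b)) ≤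
      (1 - t) * klFun a + t * klFun b - klFun ((1 - t) * a + t * b) := by
  set h := (1 - t) * a + t * b with hh
  have h1t : 0 < 1 - t := by linarith
  have hpa := mul_nonneg h1t.le ha
  have hpb := mul_nonneg ht0.le hb
  have hb0 : h = 0 → b = 0 := fun h0 => by
    have : t * b = 0 := by linarith
    simpa [ht0.ne'] using this
  have ha0 : h = 0 → a = 0 := fun h0 => by
    have : (1 - t) * a = 0 := by linarith
    simpa [h1t.ne'] using this
  have e1 := mul_le_mul_of_nonneg_left (young_mul_log hb (by linarith) hb0 v) ht0.le
  have e2 := mul_le_mul_of_nonneg_left (young_mul_log ha (by linarith) ha0 0) h1t.le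
  simp only [Real.exp_zero, mul_zero, mul_one, zero_add] at e2
  have e3 : a - h = t * (a - b) := by rw [hh]; ring
  rw [e3] at e2
  have e4 : (1 - t) * klFun a + t * klFun b - klFun h =
      t * (b * (Real.log b - Real.log h)) + (1 - t) * (a * (Real.log a - Real.log h)) := by
    simp only [klFun_apply]; rw [mul_comm h (Real.log h)]; nth_rw 2 3 [hh]; ring
  rw [e4]
  linarith

/-- The density of `ν` with respect to `α`, as a real function. -/
noncomputable def density (α : Measure E) (ν : ProbabilityMeasure E) (x : E) : ℝ :=
  ((ν : Measure E).rnDeriv α x).toReal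

lemma density_nonneg (α : Measure E) (ν : ProbabilityMeasure E) (x : E) : 0 ≤ density α ν x :=
  ENNReal.toReal_nonneg

lemma measurable_density (α : Measure E) (ν : ProbabilityMeasure E) : Measurable (density α ν) :=
  (Measure.measurable_rnDeriv _ _).ennreal_toReal

lemma integrable_density (α : Measure E) (ν : ProbabilityMeasure E) :
    Integrable (density α ν) α := Measure.integrable_toReal_rnDeriv

lemma integrable_of_bdd (μ : Measure E) [IsFiniteMeasure μ] {v : E → ℝ} (hv : Measurable v) {c : ℝ}
    (hc : ∀ x, |v x| ≤ c) : Integrable v μ :=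
  Integrable.of_bound hv.aestronglyMeasurable c (Eventually.of_forall hc)

lemma integrable_density_mul {α : Measure E} (ν : ProbabilityMeasure E) {v : E → ℝ}
    (hv : Measurable v) {c : ℝ} (hc : ∀ x, |v x| ≤ c) :
    Integrable (fun x => density α ν x * v x) α :=
  (integrable_density α ν).mul_bdd (c := c) hv.aestronglyMeasurable (Eventually.of_forall hc)

variable {α : Measure E} [IsProbabilityMeasure α]

lemma integral_density_mul {ν : ProbabilityMeasure E} (hac : (ν : Measure E) ≪ α) (v : E → ℝ) :
    ∫ x, density α ν x * v x ∂α = ∫ x, v x ∂(ν : Measure E) := by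
  simpa [density] using integral_rnDeriv_smul (f := v) hac

lemma integral_density {ν : ProbabilityMeasure E} (hac : (ν : Measure E) ≪ α) :
    ∫ x, density α ν x ∂α = 1 := by
  simpa using integral_density_mul hac (fun _ => 1)

/-- The relation `η = (1 - t) ν + t γ`. -/
def IsMix (t : ℝ) (ν γ η : ProbabilityMeasure E) : Prop :=
  (η : Measure E) = ENNReal.ofReal (1 - t) • (ν : Measure E) + ENNReal.ofReal t • (γ : Measure E)

lemma IsConvexSet.exists_mix {C : Set (ProbabilityMeasure E)} (hC : IsConvexSet C) {t : ℝ}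
    (ht0 : 0 ≤ t) (ht1 : t ≤ 1) {ν γ : ProbabilityMeasure E} (hν : ν ∈ C) (hγ : γ ∈ C) :
    ∃ η ∈ C, IsMix t ν γ η := by
  have := hC (Set.mem_image_of_mem _ hν) (Set.mem_image_of_mem _ hγ)
    (a := Real.toNNReal (1 - t)) (b := Real.toNNReal t) zero_le zero_le
    (by rw [← Real.toNNReal_add (by linarith) ht0]; simp)
  obtain ⟨η, hη, e⟩ := this
  exact ⟨η, hη, e⟩

lemma IsMix.integral {t : ℝ} (ht0 : 0 ≤ t) (ht1 : t ≤ 1) {ν γ η : ProbabilityMeasure E}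
    (h : IsMix t ν γ η) {v : E → ℝ} (h1 : Integrable v (ν : Measure E))
    (h2 : Integrable v (γ : Measure E)) :
    ∫ x, v x ∂(η : Measure E) =
      (1 - t) * ∫ x, v x ∂(ν : Measure E) + t * ∫ x, v x ∂(γ : Measure E) := by
  rw [h, integral_add_measure (h1.smul_measure ENNReal.ofReal_ne_top)
    (h2.smul_measure ENNReal.ofReal_ne_top), integral_smul_measure, integral_smul_measure,
    ENNReal.toReal_ofReal (by linarith), ENNReal.toReal_ofReal ht0, smul_eq_mul, smul_eq_mul]

lemma IsMix.density_ae_eq {t : ℝ} (ht0 : 0 ≤ t) (ht1 : t ≤ 1) {ν γ η : ProbabilityMeasure E}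
    (h : IsMix t ν γ η) :
    density α η =ᵐ[α] fun x => (1 - t) * density α ν x + t * density α γ x := by
  have : IsFiniteMeasure (ENNReal.ofReal (1 - t) • (ν : Measure E)) :=
    Measure.smul_finite _ ENNReal.ofReal_ne_top
  have : IsFiniteMeasure (ENNReal.ofReal t • (γ : Measure E)) :=
    Measure.smul_finite _ ENNReal.ofReal_ne_top
  have e1 := Measure.rnDeriv_add (ENNReal.ofReal (1 - t) • (ν : Measure E))
    (ENNReal.ofReal t • (γ : Measure E)) α
  have e2 := Measure.rnDeriv_smul_left_of_ne_top (ν : Measure E) α (r := ENNReal.ofReal (1 - t))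
    ENNReal.ofReal_ne_top
  have e3 := Measure.rnDeriv_smul_left_of_ne_top (γ : Measure E) α (r := ENNReal.ofReal t)
    ENNReal.ofReal_ne_top
  filter_upwards [e1, e2, e3, (ν : Measure E).rnDeriv_lt_top α, (γ : Measure E).rnDeriv_lt_top α]
    with x h1 h2 h3 h4 h5
  simp only [density]
  rw [h, h1, Pi.add_apply, h2, h3]
  simp only [Pi.smul_apply, smul_eq_mul]
  rw [ENNReal.toReal_add (ENNReal.mul_ne_top ENNReal.ofReal_ne_top h4.ne)
    (ENNReal.mul_ne_top ENNReal.ofReal_ne_top h5.ne), ENNReal.toReal_mul, ENNReal.toReal_mul,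
    ENNReal.toReal_ofReal (by linarith), ENNReal.toReal_ofReal ht0]

lemma klDiv_ne_top_iff_density {ν : ProbabilityMeasure E} :
    klDiv (ν : Measure E) α ≠ ∞ ↔
      (ν : Measure E) ≪ α ∧ Integrable (fun x => klFun (density α ν x)) α := by
  rw [klDiv_ne_top_iff]
  exact and_congr_right fun h => (integrable_klFun_rnDeriv_iff h).symm

/-- Dual form of the compensation inequality `t H(γ ∣ η) ≤ (1 - t) H(ν ∣ α) + t H(γ ∣ α) - H(η ∣ α)`
for `η = (1 - t) ν + t γ`: the relative entropy `H(γ ∣ η)` is replaced by `∫ v dγ + 1 - ∫ e ^ v dη`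
for an arbitrary bounded `v`. -/
theorem IsMix.klDiv_gap {t : ℝ} (ht0 : 0 < t) (ht1 : t < 1) {ν γ η : ProbabilityMeasure E}
    (h : IsMix t ν γ η) (hν : klDiv (ν : Measure E) α ≠ ∞) (hγ : klDiv (γ : Measure E) α ≠ ∞)
    {v : E → ℝ} (hv : Measurable v) {c : ℝ} (hc : ∀ x, |v x| ≤ c) :
    klDiv (η : Measure E) α ≠ ∞ ∧
    t * (∫ x, v x ∂(γ : Measure E) + 1 - ∫ x, Real.exp (v x) ∂(η : Measure E)) ≤
      (1 - t) * (klDiv (ν : Measure E) α).toReal + t * (klDiv (γ : Measure E) α).toReal -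
        (klDiv (η : Measure E) α).toReal := by
  have h1t : 0 < 1 - t := by linarith
  obtain ⟨acν, iν⟩ := klDiv_ne_top_iff_density.1 hν
  obtain ⟨acγ, iγ⟩ := klDiv_ne_top_iff_density.1 hγ
  have acη : (η : Measure E) ≪ α := by
    rw [h]
    exact Measure.AbsolutelyContinuous.add_left (acν.smul_left _) (acγ.smul_left _)
  have hd := h.density_ae_eq (α := α) ht0.le ht1.le
  have isum : Integrable (fun x => (1 - t) * klFun (density α ν x) +
    t * klFun (density α γ x)) α := (iν.const_mul _).add (iγ.const_mul _)
  have iη : Integrable (fun x => klFun (density α η x)) α := by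
    refine isum.mono' (measurable_klFun.comp (measurable_density α η)).aestronglyMeasurable ?_
    filter_upwards [hd] with x hx
    rw [Real.norm_of_nonneg (klFun_nonneg (density_nonneg _ _ _)), hx]
    exact convexOn_klFun.2 (density_nonneg _ _ _) (density_nonneg _ _ _) h1t.le ht0.le (by ring)
  refine ⟨klDiv_ne_top_iff_density.2 ⟨acη, iη⟩, ?_⟩
  have hexp : ∀ x, |Real.exp (v x)| ≤ Real.exp c := fun x => by
    rw [abs_of_pos (Real.exp_pos _)]
    exact Real.exp_le_exp.2 ((le_abs_self _).trans (hc x))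
  have j1 := integrable_density_mul (α := α) γ hv hc
  have j2 := integrable_density_mul (α := α) η hv.exp hexp
  have jγ := integrable_density α γ
  have jν := integrable_density α ν
  have k1 : Integrable (fun x => density α γ x * v x + density α γ x) α := j1.add jγ
  have k2 : Integrable (fun x => t * (density α γ x * v x + density α γ x -
      density α η x * Real.exp (v x))) α := (k1.sub j2).const_mul _
  have k3 : Integrable (fun x => (1 - t) * (t * (density α ν x - density α γ x))) α :=
    ((jν.sub jγ).const_mul _).const_mul _
  have key := integral_mono_ae (k2.add k3) (isum.sub iη) (by
    filter_upwards [hd] with x hx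
    simp only [Pi.sub_apply, Pi.add_apply]
    rw [hx]
    exact klFun_mix_gap (density_nonneg _ _ _) (density_nonneg _ _ _) ht0 ht1 (v x))
  simp only [Pi.add_apply, Pi.sub_apply] at key
  rw [integral_sub isum iη, integral_add (iν.const_mul _) (iγ.const_mul _), integral_const_mul,
    integral_const_mul, integral_add k2 k3, integral_const_mul, integral_const_mul,
    integral_const_mul, integral_sub k1 j2, integral_add j1 jγ, integral_sub jν jγ,
    integral_density acν, integral_density acγ, integral_density_mul acγ,
    integral_density_mul acη] at key
  rw [toReal_klDiv_eq_integral_klFun acν, toReal_klDiv_eq_integral_klFun acγ,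
    toReal_klDiv_eq_integral_klFun acη]
  simp only [density] at key
  linarith

end

/-! ### Generalized I-projections and the Pythagorean inequality -/

section

lemma abs_exp_le {E : Type*} {v : E → ℝ} {c : ℝ} (hc : ∀ x, |v x| ≤ c) (x : E) :
    |Real.exp (v x)| ≤ Real.exp c := by
  rw [Real.abs_exp]
  exact Real.exp_le_exp.2 ((le_abs_self _).trans (hc x))

lemma abs_indicator_one_le {E : Type*} (A : Set E) (x : E) :
    |A.indicator (fun _ => (1 : ℝ)) x| ≤ 1 := by
  by_cases h : x ∈ A <;> simp [h]

variable {E : Type*} [MeasurableSpace E] {α : Measure E}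

lemma entropyInf_toReal_le {C : Set (ProbabilityMeasure E)} {ν : ProbabilityMeasure E}
    (hν : ν ∈ C) (h : klDiv (ν : Measure E) α ≠ ∞) :
    (entropyInf C α).toReal ≤ (klDiv (ν : Measure E) α).toReal :=
  ENNReal.toReal_mono h (iInf₂_le ν hν)

lemma exists_minimizing_seq {C : Set (ProbabilityMeasure E)} (hI : entropyInf C α < ∞) :
    ∃ ν : ℕ → ProbabilityMeasure E, (∀ m, ν m ∈ C) ∧ (∀ m, klDiv (ν m : Measure E) α ≠ ∞) ∧
      Tendsto (fun m => klDiv (ν m : Measure E) α) atTop (𝓝 (entropyInf C α)) := by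
  obtain ⟨u, -, hu, hu'⟩ := exists_seq_strictAnti_tendsto' hI
  have : ∀ m, ∃ ν ∈ C, klDiv (ν : Measure E) α < u m := fun m => by
    have := (hu m).1
    rw [entropyInf] at this
    simpa [iInf_lt_iff] using this
  choose ν hν hlt using this
  exact ⟨ν, hν, fun m => ((hlt m).trans (hu m).2).ne,
    tendsto_of_tendsto_of_tendsto_of_le_of_le tendsto_const_nhds hu'
      (fun m => iInf₂_le (ν m) (hν m)) fun m => (hlt m).le⟩

lemma tendsto_real_of_tvDist {ν : ℕ → ProbabilityMeasure E} {β : ProbabilityMeasure E}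
    (h : Tendsto (fun m => tvDist (ν m) β) atTop (𝓝 0)) {A : Set E} (hA : MeasurableSet A) :
    Tendsto (fun m => (ν m : Measure E).real A) atTop (𝓝 ((β : Measure E).real A)) := by
  rw [tendsto_iff_dist_tendsto_zero]
  have h0 : Tendsto (fun m => ENNReal.ofReal (dist ((ν m : Measure E).real A)
      ((β : Measure E).real A))) atTop (𝓝 0) :=
    tendsto_of_tendsto_of_tendsto_of_le_of_le tendsto_const_nhds h (fun _ => zero_le)
      fun m => le_iSup₂ (f := fun (A : Set E) (_ : MeasurableSet A) =>
        ENNReal.ofReal |(ν m : Measure E).real A - (β : Measure E).real A|) A hA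
  have := (ENNReal.tendsto_toReal ENNReal.zero_ne_top).comp h0
  simpa [Function.comp_def, ENNReal.toReal_ofReal dist_nonneg] using this

theorem IsGenIProjection.unique {C : Set (ProbabilityMeasure E)} {β β' : ProbabilityMeasure E}
    (h : IsGenIProjection α C β) (h' : IsGenIProjection α C β') : β = β' := by
  obtain ⟨ν, hνC, -, hνlim⟩ := exists_minimizing_seq h.1
  have t := h.2 ν hνC hνlim
  have t' := h'.2 ν hνC hνlim
  refine Subtype.ext ?_
  change (β : Measure E) = (β' : Measure E)
  refine Measure.ext fun A hA => ?_
  rw [← measureReal_eq_measureReal_iff (measure_ne_top _ _) (measure_ne_top _ _)]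
  exact tendsto_nhds_unique (tendsto_real_of_tvDist t hA) (tendsto_real_of_tvDist t' hA)

variable [IsProbabilityMeasure α]

/-- The `L¹` distance of two densities is attained by testing against a function bounded by one. -/
lemma integral_abs_density_sub {ν γ : ProbabilityMeasure E} (hν : (ν : Measure E) ≪ α)
    (hγ : (γ : Measure E) ≪ α) :
    ∃ v : E → ℝ, Measurable v ∧ (∀ x, |v x| ≤ 1) ∧
      ∫ x, ‖density α ν x - density α γ x‖ ∂α =
        ∫ x, v x ∂(ν : Measure E) - ∫ x, v x ∂(γ : Measure E) := by
  classical
  -- the maximizer is the sign of the difference of the densities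
  set A : Set E := {x | density α γ x ≤ density α ν x}
  have hA : MeasurableSet A := measurableSet_le (measurable_density α γ) (measurable_density α ν)
  let v : E → ℝ := A.piecewise (fun _ => 1) (fun _ => -1)
  have hv : Measurable v := measurable_const.piecewise hA measurable_const
  have hv1 : ∀ x, |v x| ≤ 1 := fun x => by
    by_cases h : x ∈ A <;> simp [v, h]
  refine ⟨v, hv, hv1, ?_⟩
  rw [← integral_density_mul hν, ← integral_density_mul hγ,
    ← integral_sub (integrable_density_mul ν hv hv1) (integrable_density_mul γ hv hv1)]
  congr 1
  ext x
  rw [Real.norm_eq_abs, ← sub_mul]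
  by_cases h : x ∈ A
  · simp only [v, Set.piecewise_eq_of_mem _ _ _ h, mul_one]
    exact abs_of_nonneg (sub_nonneg.2 h)
  · simp only [v, Set.piecewise_eq_of_notMem _ _ _ h, mul_neg, mul_one]
    exact abs_of_neg (sub_neg.2 (not_le.1 h))

/-- Completeness for the total variation: a Cauchy sequence of probability measures dominated by `α`
has a limit. It is obtained as the measure whose density is the limit in `L¹(α)` of the
densities. -/
theorem exists_limit_of_cauchy_tv {ν : ℕ → ProbabilityMeasure E}
    (hac : ∀ m, (ν m : Measure E) ≪ α)
    (hcau : ∀ ε : ℝ, 0 < ε → ∃ N, ∀ m, N ≤ m → ∀ k, N ≤ k → ∀ v : E → ℝ, Measurable v →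
      (∀ x, |v x| ≤ 1) → ∫ x, v x ∂(ν m : Measure E) - ∫ x, v x ∂(ν k : Measure E) < ε) :
    ∃ β : ProbabilityMeasure E, (β : Measure E) ≪ α ∧
      ∀ v : E → ℝ, Measurable v → ∀ c : ℝ, (∀ x, |v x| ≤ c) →
        Tendsto (fun m => ∫ x, v x ∂(ν m : Measure E)) atTop (𝓝 (∫ x, v x ∂(β : Measure E))) := by
  let F : ℕ → (E →₁[α] ℝ) := fun m => (integrable_density α (ν m)).toL1
  have hF : CauchySeq F := by
    rw [Metric.cauchySeq_iff]
    intro ε hε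
    obtain ⟨N, hN⟩ := hcau ε hε
    refine ⟨N, fun m hm k hk => ?_⟩
    obtain ⟨v, hv, hv1, e⟩ := integral_abs_density_sub (hac m) (hac k)
    have : dist (F m) (F k) = ∫ x, ‖density α (ν m) x - density α (ν k) x‖ ∂α := by
      rw [dist_eq_norm, ← Integrable.toL1_sub, L1.norm_of_fun_eq_integral_norm]
      rfl
    rw [this, e]
    exact hN m hm k hk v hv hv1
  obtain ⟨g, hg⟩ := cauchySeq_tendsto_of_complete hF
  set f : E → ℝ := (g : E → ℝ)
  have hf : Integrable f α := L1.integrable_coeFn g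
  have hL1 : Tendsto (fun m => ∫ x, ‖density α (ν m) x - f x‖ ∂α) atTop (𝓝 0) := by
    refine (tendsto_iff_dist_tendsto_zero.1 hg).congr fun m => ?_
    rw [← Integrable.toL1_coeFn g hf, dist_eq_norm, ← Integrable.toL1_sub,
      L1.norm_of_fun_eq_integral_norm]
    rfl
  have hlim : ∀ v : E → ℝ, Measurable v → ∀ c : ℝ, (∀ x, |v x| ≤ c) →
      Tendsto (fun m => ∫ x, v x ∂(ν m : Measure E)) atTop (𝓝 (∫ x, f x * v x ∂α)) := by
    intro v hv c hc
    rw [tendsto_iff_dist_tendsto_zero]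
    have hL1' : Tendsto (fun m => (∫ x, ‖density α (ν m) x - f x‖ ∂α) * c) atTop (𝓝 0) := by
      simpa using hL1.mul_const c
    refine squeeze_zero (fun m => dist_nonneg) (fun m => ?_) hL1'
    have hd := (integrable_density α (ν m)).sub hf
    have hfv : Integrable (fun x => f x * v x) α :=
      hf.mul_bdd (c := c) hv.aestronglyMeasurable (Eventually.of_forall hc)
    rw [← integral_density_mul (hac m), Real.dist_eq,
      ← integral_sub (integrable_density_mul (ν m) hv hc) hfv, ← integral_mul_const,
      ← Real.norm_eq_abs]
    refine (norm_integral_le_integral_norm _).trans ?_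
    refine integral_mono_of_nonneg (Eventually.of_forall fun x => norm_nonneg _)
      (hd.norm.mul_const c) (Eventually.of_forall fun x => ?_)
    beta_reduce
    rw [← sub_mul, norm_mul]
    exact mul_le_mul_of_nonneg_left (hc x) (norm_nonneg _)
  have hf0 : 0 ≤ᵐ[α] f := by
    refine ae_nonneg_of_forall_setIntegral_nonneg hf fun A hA _ => ?_
    have hi := hlim (A.indicator fun _ => 1) (measurable_const.indicator hA) 1 (fun x => by
      by_cases h : x ∈ A <;> simp [h])
    have e : ∫ x in A, f x ∂α = ∫ x, f x * A.indicator (fun _ => 1) x ∂α := by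
      rw [← integral_indicator hA]
      congr 1
      ext x
      by_cases h : x ∈ A <;> simp [h]
    rw [e]
    exact ge_of_tendsto' hi fun m => integral_nonneg fun x =>
      Set.indicator_nonneg (fun _ _ => zero_le_one) x
  have hf1 : ∫ x, f x ∂α = 1 := by
    have hi := hlim (fun _ => 1) measurable_const 1 (fun x => by simp)
    simp only [mul_one, integral_const, probReal_univ, smul_eq_mul] at hi
    exact tendsto_nhds_unique hi tendsto_const_nhds
  let β : Measure E := α.withDensity fun x => ENNReal.ofReal (f x)
  have hβ : IsProbabilityMeasure β := ⟨by
    rw [withDensity_apply _ MeasurableSet.univ, Measure.restrict_univ,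
      ← ofReal_integral_eq_lintegral_ofReal hf hf0, hf1, ENNReal.ofReal_one]⟩
  refine ⟨⟨β, hβ⟩, withDensity_absolutelyContinuous _ _, fun v hv c hc => ?_⟩
  have e : ∫ x, v x ∂β = ∫ x, f x * v x ∂α := by
    rw [integral_withDensity_eq_integral_toReal_smul₀ hf.aemeasurable.ennreal_ofReal
      (Eventually.of_forall fun x => ENNReal.ofReal_lt_top)]
    refine integral_congr_ae ?_
    filter_upwards [hf0] with x hx
    rw [ENNReal.toReal_ofReal hx, smul_eq_mul]
  change Tendsto _ _ (𝓝 (∫ x, v x ∂β))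
  rw [e]
  exact hlim v hv c hc

lemma exp_le_one_add_add_sq {u : ℝ} (hu : |u| ≤ 1) : Real.exp u ≤ 1 + u + u ^ 2 := by
  have := Real.abs_exp_sub_one_sub_id_le hu
  linarith [le_abs_self (Real.exp u - 1 - u)]

/-- Quantitative uniqueness of almost minimizers of the entropy on a convex set. It is the
compensation inequality at the midpoint, whose entropy is at least the infimum, tested against
`s v`. -/
theorem integral_sub_le_of_convex {C : Set (ProbabilityMeasure E)} (hC : IsConvexSet C)
    {ν γ : ProbabilityMeasure E} (hνC : ν ∈ C) (hγC : γ ∈ C)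
    (hν : klDiv (ν : Measure E) α ≠ ∞) (hγ : klDiv (γ : Measure E) α ≠ ∞)
    {v : E → ℝ} (hv : Measurable v) (hv1 : ∀ x, |v x| ≤ 1) {s : ℝ} (hs0 : 0 < s) (hs1 : s ≤ 1) :
    ∫ x, v x ∂(γ : Measure E) - ∫ x, v x ∂(ν : Measure E) ≤
      2 * ((klDiv (ν : Measure E) α).toReal + (klDiv (γ : Measure E) α).toReal -
        2 * (entropyInf C α).toReal) / s + 2 * s := by
  obtain ⟨η, hηC, hη⟩ := hC.exists_mix (t := 1 / 2) (by norm_num) (by norm_num) hνC hγC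
  have hsv : ∀ x, |s * v x| ≤ s := fun x => by
    rw [abs_mul, abs_of_pos hs0]
    exact mul_le_of_le_one_right hs0.le (hv1 x)
  obtain ⟨hη', key⟩ := hη.klDiv_gap (by norm_num) (by norm_num) hν hγ (hv.const_mul s) hsv
  have hI := entropyInf_toReal_le hηC hη'
  have hint := hη.integral (by norm_num) (by norm_num)
    (integrable_of_bdd (ν : Measure E) hv hv1) (integrable_of_bdd (γ : Measure E) hv hv1)
  have hvη := integrable_of_bdd (η : Measure E) hv hv1
  have hexp : ∫ x, Real.exp (s * v x) ∂(η : Measure E) ≤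
      ∫ x, (1 + s ^ 2) + s * v x ∂(η : Measure E) := by
    refine integral_mono_of_nonneg (Eventually.of_forall fun x => (Real.exp_pos _).le)
      ((integrable_const _).add (hvη.const_mul s)) (Eventually.of_forall fun x => ?_)
    have h1 := exp_le_one_add_add_sq ((hsv x).trans hs1)
    have h2 := sq_le_sq' (neg_le_of_abs_le (hsv x)) (le_of_abs_le (hsv x))
    simp only
    linarith
  rw [integral_add (integrable_const _) (hvη.const_mul s), integral_const, integral_const_mul]
    at hexp
  rw [integral_const_mul] at key
  simp only [probReal_univ, smul_eq_mul, one_mul] at hexp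
  rw [hint] at hexp
  have h2 : s * (∫ x, v x ∂(γ : Measure E) - ∫ x, v x ∂(ν : Measure E)) ≤
      2 * ((klDiv (ν : Measure E) α).toReal + (klDiv (γ : Measure E) α).toReal -
        2 * (entropyInf C α).toReal) + 2 * s ^ 2 := by
    linarith
  have h3 : 2 * ((klDiv (ν : Measure E) α).toReal + (klDiv (γ : Measure E) α).toReal -
        2 * (entropyInf C α).toReal) / s + 2 * s =
      (2 * ((klDiv (ν : Measure E) α).toReal + (klDiv (γ : Measure E) α).toReal -
        2 * (entropyInf C α).toReal) + 2 * s ^ 2) / s := by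
    field_simp
  rw [h3, le_div_iff₀ hs0]
  linarith

lemma integral_indicator_one_eq (μ : Measure E) {A : Set E} (hA : MeasurableSet A) :
    ∫ x, A.indicator (fun _ => (1 : ℝ)) x ∂μ = μ.real A := by
  rw [integral_indicator hA]; simp

/-- Existence of the generalized `I`-projection `β` on a convex set. It is dominated by `α`, and
some minimizing sequence converges to it when tested against bounded functions. -/
theorem exists_isGenIProjection {C : Set (ProbabilityMeasure E)} (hC : IsConvexSet C)
    (hI : entropyInf C α < ∞) :
    ∃ β : ProbabilityMeasure E, IsGenIProjection α C β ∧ (β : Measure E) ≪ α ∧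
      ∃ ν : ℕ → ProbabilityMeasure E, (∀ m, ν m ∈ C) ∧ (∀ m, klDiv (ν m : Measure E) α ≠ ∞) ∧
        Tendsto (fun m => klDiv (ν m : Measure E) α) atTop (𝓝 (entropyInf C α)) ∧
        ∀ v : E → ℝ, Measurable v → ∀ c : ℝ, (∀ x, |v x| ≤ c) →
          Tendsto (fun m => ∫ x, v x ∂(ν m : Measure E)) atTop
            (𝓝 (∫ x, v x ∂(β : Measure E))) := by
  obtain ⟨ν, hνC, hν, hνlim⟩ := exists_minimizing_seq hI
  set I := (entropyInf C α).toReal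
  have hνlim' : Tendsto (fun m => (klDiv (ν m : Measure E) α).toReal) atTop (𝓝 I) :=
    (ENNReal.tendsto_toReal hI.ne).comp hνlim
  have hcau : ∀ ε : ℝ, 0 < ε → ∃ N, ∀ m, N ≤ m → ∀ k, N ≤ k → ∀ v : E → ℝ, Measurable v →
      (∀ x, |v x| ≤ 1) → ∫ x, v x ∂(ν m : Measure E) - ∫ x, v x ∂(ν k : Measure E) < ε := by
    intro ε hε
    obtain ⟨s, hs0, hs1, hsε⟩ : ∃ s : ℝ, 0 < s ∧ s ≤ 1 ∧ 4 * s ≤ ε :=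
      ⟨min 1 (ε / 4), lt_min one_pos (by linarith), min_le_left _ _,
        by linarith [min_le_right 1 (ε / 4)]⟩
    have hev : ∀ᶠ m in atTop, (klDiv (ν m : Measure E) α).toReal < I + s ^ 2 / 4 :=
      hνlim'.eventually_lt_const (by have := pow_pos hs0 2; linarith)
    obtain ⟨N, hN⟩ := eventually_atTop.1 hev
    refine ⟨N, fun m hm k hk v hv hv1 => ?_⟩
    refine (integral_sub_le_of_convex hC (hνC k) (hνC m) (hν k) (hν m) hv hv1 hs0 hs1).trans_lt ?_
    have h1 := hN m hm
    have h2 := hN k hk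
    have : 2 * ((klDiv (ν k : Measure E) α).toReal + (klDiv (ν m : Measure E) α).toReal -
        2 * I) / s < s := by
      rw [div_lt_iff₀ hs0]
      nlinarith
    linarith
  obtain ⟨β, hβ, hlim⟩ := exists_limit_of_cauchy_tv
    (fun m => (klDiv_ne_top_iff.1 (hν m)).1) hcau
  refine ⟨β, ⟨hI, fun γ hγC hγlim => ?_⟩, hβ, ν, hνC, hν, hνlim, hlim⟩
  have hγlim' : Tendsto (fun m => (klDiv (γ m : Measure E) α).toReal) atTop (𝓝 I) :=
    (ENNReal.tendsto_toReal hI.ne).comp hγlim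
  -- the distance from `γ m` to `β` is controlled by its distances to `ν k`, in the limit `k → ∞`
  have hbound : ∀ m, klDiv (γ m : Measure E) α ≠ ∞ → ∀ s : ℝ, 0 < s → s ≤ 1 →
      tvDist (γ m) β ≤
        ENNReal.ofReal (2 * ((klDiv (γ m : Measure E) α).toReal - I) / s + 2 * s) := by
    intro m hm s hs0 hs1
    refine iSup₂_le fun A hA => ENNReal.ofReal_le_ofReal ?_
    have hA' : Measurable (A.indicator fun _ => (1 : ℝ)) := measurable_const.indicator hA
    have t1 := hlim _ hA' 1 (abs_indicator_one_le A)
    simp only [integral_indicator_one_eq _ hA] at t1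
    have t2 : Tendsto (fun k => 2 * ((klDiv (ν k : Measure E) α).toReal +
        (klDiv (γ m : Measure E) α).toReal - 2 * I) / s + 2 * s) atTop
        (𝓝 (2 * (I + (klDiv (γ m : Measure E) α).toReal - 2 * I) / s + 2 * s)) :=
      (((hνlim'.add_const _).sub_const _).const_mul 2 |>.div_const s).add_const _
    rw [show 2 * (I + (klDiv (γ m : Measure E) α).toReal - 2 * I) / s + 2 * s =
      2 * ((klDiv (γ m : Measure E) α).toReal - I) / s + 2 * s by ring] at t2
    refine le_of_tendsto_of_tendsto' (tendsto_const_nhds.sub t1).abs t2 fun k => ?_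
    have b1 := integral_sub_le_of_convex hC (hνC k) (hγC m) (hν k) hm hA'
      (abs_indicator_one_le A) hs0 hs1
    have b2 := integral_sub_le_of_convex hC (hγC m) (hνC k) hm (hν k) hA'
      (abs_indicator_one_le A) hs0 hs1
    rw [integral_indicator_one_eq _ hA, integral_indicator_one_eq _ hA] at b1 b2
    rw [add_comm (klDiv (γ m : Measure E) α).toReal] at b2
    exact abs_sub_le_iff.2 ⟨b1, b2⟩
  rw [ENNReal.tendsto_nhds_zero]
  intro ε hε
  obtain ⟨δ, hδ0, hδε⟩ : ∃ δ : ℝ, 0 < δ ∧ ENNReal.ofReal δ ≤ ε := by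
    rcases eq_or_ne ε ∞ with rfl | hε'
    · exact ⟨1, one_pos, le_top⟩
    · exact ⟨ε.toReal, ENNReal.toReal_pos hε.ne' hε', ENNReal.ofReal_toReal_le⟩
  obtain ⟨s, hs0, hs1, hsε⟩ : ∃ s : ℝ, 0 < s ∧ s ≤ 1 ∧ 4 * s ≤ δ :=
    ⟨min 1 (δ / 4), lt_min one_pos (by linarith), min_le_left _ _,
      by linarith [min_le_right 1 (δ / 4)]⟩
  have e1 : ∀ᶠ m in atTop, (klDiv (γ m : Measure E) α).toReal < I + s ^ 2 :=
    hγlim'.eventually_lt_const (by have := pow_pos hs0 2; linarith)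
  have e2 : ∀ᶠ m in atTop, klDiv (γ m : Measure E) α < ∞ := hγlim.eventually_lt_const hI
  filter_upwards [e1, e2] with m h1 h2
  refine (hbound m h2.ne s hs0 hs1).trans ((ENNReal.ofReal_le_ofReal ?_).trans hδε)
  have : 2 * ((klDiv (γ m : Measure E) α).toReal - I) / s ≤ 2 * s := by
    rw [div_le_iff₀ hs0]
    nlinarith
  linarith

/-- The variational form of `H(γ ∣ β) ≤ D`, tested on bounded measurable functions. The dual
expression used here, with `1 - ∫ e ^ v dβ` in place of `-log ∫ e ^ v dβ`, is affine in `β` and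
therefore well behaved under mixtures and limits; both have the same supremum over `v` when `γ` and
`β` are probability measures. -/
def VarEntropyLE (γ β : Measure E) (D : ℝ) : Prop :=
  ∀ v : E → ℝ, Measurable v → ∀ c : ℝ, (∀ x, |v x| ≤ c) →
    ∫ x, v x ∂γ + 1 - ∫ x, Real.exp (v x) ∂β ≤ D

/-- Pythagorean inequality `H(γ ∣ β) ≤ H(γ ∣ α) - H(C ∣ α)` for the generalized `I`-projection `β`
on `C`, in variational form. -/
theorem varEntropyLE_of_isGenIProjection {C : Set (ProbabilityMeasure E)} (hC : IsConvexSet C)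
    {β : ProbabilityMeasure E} (hβ : IsGenIProjection α C β) {γ : ProbabilityMeasure E}
    (hγC : γ ∈ C) (hγ : klDiv (γ : Measure E) α ≠ ∞) :
    VarEntropyLE (γ : Measure E) (β : Measure E)
      ((klDiv (γ : Measure E) α).toReal - (entropyInf C α).toReal) := by
  intro v hv c hc
  obtain ⟨β', hβ', -, ν, hνC, hν, hνlim, hlim⟩ := exists_isGenIProjection hC hβ.1
  obtain rfl := hβ.unique hβ'
  set I := (entropyInf C α).toReal
  have hνlim' : Tendsto (fun m => (klDiv (ν m : Measure E) α).toReal) atTop (𝓝 I) :=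
    (ENNReal.tendsto_toReal hβ.1.ne).comp hνlim
  have hexp := abs_exp_le hc
  have tν := hlim _ hv.exp _ hexp
  -- the mixtures of `γ` with a minimizing sequence stay in `C`, so that their entropy is at least
  -- `I`; let the sequence converge for fixed `t`, and then `t` tend to `0`
  have hmix : ∀ t : ℝ, 0 < t → t < 1 →
      ∫ x, v x ∂(γ : Measure E) + 1 - ((1 - t) * ∫ x, Real.exp (v x) ∂(β : Measure E) +
        t * ∫ x, Real.exp (v x) ∂(γ : Measure E)) ≤ (klDiv (γ : Measure E) α).toReal - I := by
    intro t ht0 ht1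
    have l1 := (((tν.const_mul (1 - t)).add_const
      (t * ∫ x, Real.exp (v x) ∂(γ : Measure E))).const_sub
        (∫ x, v x ∂(γ : Measure E) + 1)).const_mul t
    have l2 := ((hνlim'.const_mul (1 - t)).add_const
      (t * (klDiv (γ : Measure E) α).toReal)).sub_const I
    have := le_of_tendsto_of_tendsto' l1 l2 fun m => by
      obtain ⟨η, hηC, hη⟩ := hC.exists_mix ht0.le ht1.le (hνC m) hγC
      obtain ⟨hη', key⟩ := hη.klDiv_gap ht0 ht1 (hν m) hγ hv hc
      have hI := entropyInf_toReal_le hηC hη'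
      rw [hη.integral ht0.le ht1.le (integrable_of_bdd _ hv.exp hexp)
        (integrable_of_bdd _ hv.exp hexp)] at key
      linarith
    refine le_of_mul_le_mul_left (this.trans_eq ?_) ht0
    ring
  have l3 : Tendsto (fun t : ℝ => ∫ x, v x ∂(γ : Measure E) + 1 -
      ((1 - t) * ∫ x, Real.exp (v x) ∂(β : Measure E) +
        t * ∫ x, Real.exp (v x) ∂(γ : Measure E))) (𝓝[>] 0)
      (𝓝 (∫ x, v x ∂(γ : Measure E) + 1 -
      ((1 - 0) * ∫ x, Real.exp (v x) ∂(β : Measure E) +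
        0 * ∫ x, Real.exp (v x) ∂(γ : Measure E)))) :=
    ((by fun_prop : Continuous fun t : ℝ => ∫ x, v x ∂(γ : Measure E) + 1 -
      ((1 - t) * ∫ x, Real.exp (v x) ∂(β : Measure E) +
        t * ∫ x, Real.exp (v x) ∂(γ : Measure E))).tendsto 0).mono_left nhdsWithin_le_nhds
  have := le_of_tendsto l3 (by
    filter_upwards [Ioo_mem_nhdsGT (zero_lt_one (α := ℝ))] with t ht using hmix t ht.1 ht.2)
  simpa using this

/-- The Pythagorean inequality along a minimizing sequence of `C' ⊆ C`, in the limit. It bounds the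
entropy of the generalized `I`-projection on `C'` with respect to that on `C`, without using lower
semicontinuity of the entropy. -/
theorem varEntropyLE_of_isGenIProjection_subset {C C' : Set (ProbabilityMeasure E)}
    (hC : IsConvexSet C) (hC' : IsConvexSet C') (hsub : C' ⊆ C) {β β' : ProbabilityMeasure E}
    (hβ : IsGenIProjection α C β) (hβ' : IsGenIProjection α C' β') :
    VarEntropyLE (β' : Measure E) (β : Measure E)
      ((entropyInf C' α).toReal - (entropyInf C α).toReal) := by
  intro v hv c hc
  obtain ⟨β'', hβ'', -, ν, hνC, hν, hνlim, hlim⟩ := exists_isGenIProjection hC' hβ'.1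
  obtain rfl := hβ'.unique hβ''
  have hνlim' : Tendsto (fun m => (klDiv (ν m : Measure E) α).toReal) atTop
      (𝓝 (entropyInf C' α).toReal) := (ENNReal.tendsto_toReal hβ'.1.ne).comp hνlim
  exact le_of_tendsto_of_tendsto' (((hlim v hv c hc).add_const 1).sub_const _)
    (hνlim'.sub_const _) fun m =>
      varEntropyLE_of_isGenIProjection hC hβ (hsub (hνC m)) (hν m) v hv c hc

end

/-! ### The conditional law of the first observation -/

section

variable {E : Type*} [MeasurableSpace E] {α : Measure E}

lemma empiricalMeasure_comp_equiv (n : ℕ+) (σ : Fin n ≃ Fin n) (x : Fin n → E) :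
    empiricalMeasure n (x ∘ σ) = empiricalMeasure n x := by
  simp only [empiricalMeasure, Function.comp_apply]
  rw [σ.sum_comp (fun i => Measure.dirac (x i))]

lemma integrable_dirac_of_measurable (n : ℕ+) (x : Fin n → E) {g : E → ℝ} (hg : Measurable g)
    (i : Fin n) :
    Integrable g (Measure.dirac (x i)) :=
  integrable_dirac' hg.stronglyMeasurable (by simp)

lemma integrable_empiricalMeasure (n : ℕ+) (x : Fin n → E) {g : E → ℝ} (hg : Measurable g) :
    Integrable g (empiricalMeasure n x) :=
  Integrable.smul_measure
    (integrable_finsetSum_measure.2 fun i _ => integrable_dirac_of_measurable n x hg i)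
    (by simp)

lemma integral_empiricalMeasure (n : ℕ+) (x : Fin n → E) {g : E → ℝ} (hg : Measurable g) :
    ∫ y, g y ∂(empiricalMeasure n x) = (n : ℝ)⁻¹ * ∑ i, g (x i) := by
  rw [empiricalMeasure, integral_smul_measure,
    integral_finsetSum_measure fun i _ => integrable_dirac_of_measurable n x hg i]
  simp only [integral_dirac' _ _ hg.stronglyMeasurable]
  simp

variable [IsProbabilityMeasure α]

instance (n : ℕ+) : IsProbabilityMeasure (sampleLaw α n) := by
  unfold sampleLaw; infer_instance

/-- The law of the whole sample conditioned on the event `L_n ∈ A`. -/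
noncomputable def condSampleLaw (α : Measure E) (n : ℕ+) (A : Set (ProbabilityMeasure E)) :
    Measure (Fin n → E) :=
  ProbabilityTheory.cond (sampleLaw α n) (empiricalEvent n A)

/-- The conditioned sample is exchangeable, since the event `L_n ∈ A` is invariant under
permutations: all its coordinates have the same law. -/
lemma condSampleLaw_map_eval (n : ℕ+) (A : Set (ProbabilityMeasure E)) (i : Fin n) :
    (condSampleLaw α n A).map (fun x => x i) = conditionalLaw α n A := by
  let σ : Fin n ≃ Fin n := Equiv.swap 0 i
  let e : (Fin n → E) ≃ᵐ (Fin n → E) := MeasurableEquiv.piCongrLeft (fun _ => E) σ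
  have he : ∀ x j, e x (σ j) = x j := fun x j =>
    Equiv.piCongrLeft_apply_apply (fun _ => E) σ x j
  have hmp : (sampleLaw α n).map e = sampleLaw α n :=
    (measurePreserving_piCongrLeft (fun _ => α) σ).map_eq
  have hS : e ⁻¹' empiricalEvent n A = empiricalEvent n A := by
    ext x
    have : empiricalMeasure n (e x) = empiricalMeasure n x := by
      rw [← empiricalMeasure_comp_equiv n σ (e x)]
      congr 1
      ext j
      exact he x j
    simp only [empiricalEvent, Set.mem_preimage, Set.mem_ofPred_eq, this]
  have hQ : (condSampleLaw α n A).map e = condSampleLaw α n A := by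
    rw [condSampleLaw, ProbabilityTheory.cond, Measure.map_smul]
    nth_rw 2 [← hS]
    rw [← e.restrict_map, hmp]
  nth_rw 1 [← hQ]
  rw [Measure.map_map (measurable_pi_apply i) e.measurable]
  congr 1
  ext x
  have : i = σ 0 := by simp [σ]
  simp only [Function.comp_apply]
  rw [this, he]

lemma conditionalLaw_le (n : ℕ+) (A : Set (ProbabilityMeasure E)) :
    conditionalLaw α n A ≤ (sampleLaw α n (empiricalEvent n A))⁻¹ • α := by
  have h : (sampleLaw α n).map (fun x => x 0) = α :=
    (measurePreserving_eval (fun _ : Fin n => α) 0).map_eq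
  rw [conditionalLaw, ProbabilityTheory.cond, Measure.map_smul]
  refine Measure.le_intro fun B hB _ => ?_
  simp only [Measure.smul_apply]
  gcongr
  conv_rhs => rw [← h]
  exact Measure.map_mono Measure.restrict_le_self (measurable_pi_apply 0)

variable {n : ℕ+} {A : Set (ProbabilityMeasure E)}

lemma isProbabilityMeasure_condSampleLaw (hS : sampleLaw α n (empiricalEvent n A) ≠ 0) :
    IsProbabilityMeasure (condSampleLaw α n A) :=
  ProbabilityTheory.cond_isProbabilityMeasure hS

lemma isProbabilityMeasure_conditionalLaw (hS : sampleLaw α n (empiricalEvent n A) ≠ 0) :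
    IsProbabilityMeasure (conditionalLaw α n A) := by
  have := isProbabilityMeasure_condSampleLaw hS
  rw [← condSampleLaw_map_eval n A 0]
  exact Measure.isProbabilityMeasure_map (measurable_pi_apply 0).aemeasurable

lemma integrable_conditionalLaw (hS : sampleLaw α n (empiricalEvent n A) ≠ 0) {g : E → ℝ}
    (hg : Integrable g α) : Integrable g (conditionalLaw α n A) :=
  (hg.smul_measure (ENNReal.inv_ne_top.2 hS)).mono_measure (conditionalLaw_le n A)

lemma integrable_condSampleLaw_eval {g : E → ℝ} (hg : Integrable g (conditionalLaw α n A))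
    (i : Fin n) : Integrable (fun x => g (x i)) (condSampleLaw α n A) := by
  rw [← condSampleLaw_map_eval n A i] at hg
  exact hg.comp_measurable (measurable_pi_apply i)

lemma integral_condSampleLaw_eval {g : E → ℝ} (hg : Measurable g)
    (i : Fin n) :
    ∫ x, g (x i) ∂(condSampleLaw α n A) = ∫ y, g y ∂(conditionalLaw α n A) := by
  rw [← condSampleLaw_map_eval n A i,
    integral_map (measurable_pi_apply i).aemeasurable hg.aestronglyMeasurable]

lemma integral_condSampleLaw_empirical {g : E → ℝ} (hg : Measurable g)
    (hgi : Integrable g (conditionalLaw α n A)) :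
    ∫ x, (n : ℝ)⁻¹ * ∑ i, g (x i) ∂(condSampleLaw α n A) = ∫ y, g y ∂(conditionalLaw α n A) := by
  rw [integral_const_mul, integral_finsetSum _ fun i _ => integrable_condSampleLaw_eval hgi i]
  simp only [integral_condSampleLaw_eval hg]
  simp

/-- The conditional law of `X_1` given `L_n ∈ A` belongs to `A`. By exchangeability it is the mean
of `L_n` over the event, and a set which is convex and closed for the `G`-topology contains such
means, as seen on the moments with respect to finitely many functions of `G`. -/
theorem conditionalLaw_mem {G : Set (E → ℝ)} (hGmeas : ∀ g ∈ G, Measurable g)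
    (hGint : ∀ g ∈ G, Integrable g α) (hA : IsConvexSet A) (hcl : IsGClosed G A)
    (hnull : NullMeasurableSet (empiricalEvent n A) (sampleLaw α n))
    (hS : sampleLaw α n (empiricalEvent n A) ≠ 0) :
    ∃ π ∈ A, (π : Measure E) = conditionalLaw α n A := by
  have hQ := isProbabilityMeasure_condSampleLaw hS
  have hπ := isProbabilityMeasure_conditionalLaw hS
  let π : ProbabilityMeasure E := ⟨conditionalLaw α n A, hπ⟩
  refine ⟨π, ?_, rfl⟩
  let π' : IntegratingMeasures G := ⟨π, fun g hg => integrable_conditionalLaw hS (hGint g hg)⟩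
  obtain ⟨K, hK, hKA⟩ := isClosed_induced_iff.1 hcl
  suffices h : π' ∈ {ν : IntegratingMeasures G | ν.1 ∈ A} from h
  rw [← hKA]
  by_contra hπK
  obtain ⟨I, u, hu, hIu⟩ := isOpen_pi_iff.1 hK.isOpen_compl _ hπK
  -- the moments of the members of `A` with respect to the finitely many functions of `I`
  let s : Set (I → ℝ) := {m | ∃ ν ∈ A, (∀ g ∈ G, Integrable g (ν : Measure E)) ∧
    m = fun g : I => ∫ y, (g.1 : E → ℝ) y ∂(ν : Measure E)}
  have hsconv : Convex ℝ s := by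
    rintro _ ⟨ν, hν, hνG, rfl⟩ _ ⟨γ, hγ, hγG, rfl⟩ a b ha hb hab
    obtain rfl : a = 1 - b := by linarith
    obtain ⟨η, hη, hmix⟩ := hA.exists_mix hb (by linarith) hν hγ
    refine ⟨η, hη, fun g hg => ?_, ?_⟩
    · rw [hmix]
      exact ((hνG g hg).smul_measure ENNReal.ofReal_ne_top).add_measure
        ((hγG g hg).smul_measure ENNReal.ofReal_ne_top)
    · ext g
      simp only [Pi.add_apply, Pi.smul_apply, smul_eq_mul]
      rw [hmix.integral hb (by linarith) (hνG _ g.1.2) (hγG _ g.1.2)]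
  let Φ : (Fin n → E) → I → ℝ := fun x g => (n : ℝ)⁻¹ * ∑ i, (g.1 : E → ℝ) (x i)
  have hΦs : ∀ᵐ x ∂(condSampleLaw α n A), Φ x ∈ closure s := by
    refine Measure.ae_smul_measure ?_ _
    filter_upwards [ae_restrict_mem₀ hnull] with x hx
    obtain ⟨ν, hν, e⟩ := hx
    refine subset_closure ⟨ν, hν, fun g hg => ?_, ?_⟩
    · rw [e]; exact integrable_empiricalMeasure n x (hGmeas g hg)
    · ext g
      rw [e, integral_empiricalMeasure n x (hGmeas _ g.1.2)]
  have hΦi : ∀ g : I, Integrable (fun x => Φ x g) (condSampleLaw α n A) := fun g =>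
    (integrable_finsetSum _ fun i _ => integrable_condSampleLaw_eval
      (integrable_conditionalLaw hS (hGint _ g.1.2)) i).const_mul _
  have hmem := hsconv.closure.integral_mem isClosed_closure hΦs (Integrable.of_eval hΦi)
  have hval : ∀ g : I, (∫ x, Φ x ∂(condSampleLaw α n A)) g =
      ∫ y, (g.1 : E → ℝ) y ∂(conditionalLaw α n A) := fun g => by
    rw [eval_integral hΦi]
    exact integral_condSampleLaw_empirical (hGmeas _ g.1.2)
      (integrable_conditionalLaw hS (hGint _ g.1.2))
  have hopen : IsOpen (Set.univ.pi fun g : I => u g.1) :=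
    isOpen_set_pi Set.finite_univ fun g _ => (hu g.1 g.2).1
  obtain ⟨m, hm, ν, hν, hνG, rfl⟩ := mem_closure_iff.1 hmem _ hopen fun g _ => by
    rw [hval]
    exact (hu g.1 g.2).2
  have hν' : (⟨ν, hνG⟩ : IntegratingMeasures G) ∈ {ν : IntegratingMeasures G | ν.1 ∈ A} := hν
  rw [← hKA] at hν'
  exact hIu (fun g hg => hm ⟨g, hg⟩ trivial) hν'

lemma density_le_of_le_smul {π : ProbabilityMeasure E} {K : ℝ≥0∞} (hK : K ≠ ∞)
    (h : (π : Measure E) ≤ K • α) : ∀ᵐ x ∂α, density α π x ≤ K.toReal := by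
  have : (π : Measure E).rnDeriv α ≤ᵐ[α] fun _ => K := by
    refine ae_le_of_forall_setLIntegral_le_of_sigmaFinite (Measure.measurable_rnDeriv _ _)
      fun s hs _ => ?_
    rw [setLIntegral_const]
    exact (Measure.setLIntegral_rnDeriv_le s).trans (h s)
  filter_upwards [this] with x hx using ENNReal.toReal_mono hK hx

/-- The conditional law `π` of `X_1` given `L_n ∈ A` has entropy
`H(π ∣ α) ≤ -(1 / n) log P(L_n ∈ A)`. This is superadditivity of the entropy for the conditioned
sample, whose density is `1_{L_n ∈ A} / P(L_n ∈ A)`. -/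
theorem klDiv_conditionalLaw_le (hS : sampleLaw α n (empiricalEvent n A) ≠ 0) :
    klDiv (conditionalLaw α n A) α ≠ ∞ ∧
      n * (klDiv (conditionalLaw α n A) α).toReal ≤
        -Real.log (sampleLaw α n (empiricalEvent n A)).toReal := by
  have hQ := isProbabilityMeasure_condSampleLaw hS
  have hπ := isProbabilityMeasure_conditionalLaw hS
  let π : ProbabilityMeasure E := ⟨conditionalLaw α n A, hπ⟩
  set c : ℝ := (sampleLaw α n (empiricalEvent n A)).toReal with hc
  have hc0 : 0 < c := ENNReal.toReal_pos hS (measure_ne_top _ _)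
  have hle : (π : Measure E) ≤ (sampleLaw α n (empiricalEvent n A))⁻¹ • α := conditionalLaw_le n A
  have hac : (π : Measure E) ≪ α :=
    (Measure.absolutelyContinuous_of_le hle).trans Measure.smul_absolutelyContinuous
  have hd := density_le_of_le_smul (ENNReal.inv_ne_top.2 hS) hle
  set B := ((sampleLaw α n (empiricalEvent n A))⁻¹).toReal
  -- the density is bounded by `B`, hence the entropy is finite
  have hkl : klDiv (π : Measure E) α ≠ ∞ := by
    obtain ⟨M, hM⟩ := (isCompact_Icc (a := (0 : ℝ)) (b := B)).exists_bound_of_continuousOn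
      continuous_klFun.continuousOn
    refine klDiv_ne_top_iff_density.2 ⟨hac, Integrable.of_bound
      (measurable_klFun.comp (measurable_density α π)).aestronglyMeasurable M ?_⟩
    filter_upwards [hd] with x hx using hM _ ⟨density_nonneg _ _ _, hx⟩
  refine ⟨hkl, ?_⟩
  have hllr : Integrable (fun y => Real.log (density α π y)) (conditionalLaw α n A) :=
    (klDiv_ne_top_iff.1 hkl).2
  have hpos : ∀ᵐ y ∂(conditionalLaw α n A), 0 < density α π y := by
    filter_upwards [Measure.rnDeriv_pos (μ := conditionalLaw α n A) hac,
      hac.ae_le ((π : Measure E).rnDeriv_lt_top α)]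
      with y h1 h2 using ENNReal.toReal_pos h1.ne' h2.ne
  have hposQ : ∀ᵐ x ∂(condSampleLaw α n A), ∀ i, 0 < density α π (x i) := by
    rw [ae_all_iff]
    intro i
    rw [← condSampleLaw_map_eval n A i] at hpos
    exact ae_of_ae_map (measurable_pi_apply i).aemeasurable hpos
  have hprodP : Integrable (fun x : Fin n → E => ∏ i, density α π (x i)) (sampleLaw α n) :=
    Integrable.fintype_prod fun _ => integrable_density α π
  have hprodQ : Integrable (fun x : Fin n → E => ∏ i, density α π (x i)) (condSampleLaw α n A) :=
    hprodP.integrableOn.smul_measure (ENNReal.inv_ne_top.2 hS)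
  have hprod : c * ∫ x, ∏ i, density α π (x i) ∂(condSampleLaw α n A) ≤ 1 := by
    rw [condSampleLaw, ProbabilityTheory.cond, integral_smul_measure, smul_eq_mul,
      ENNReal.toReal_inv, ← hc, mul_inv_cancel_left₀ hc0.ne']
    refine (setIntegral_le_integral hprodP (Eventually.of_forall fun x =>
      Finset.prod_nonneg fun i _ => density_nonneg _ _ _)).trans ?_
    rw [sampleLaw, integral_fintype_prod_eq_prod (fun _ => density α π)]
    simp [integral_density hac]
  have hlogi : ∀ i : Fin n, Integrable (fun x => Real.log (density α π (x i)))
      (condSampleLaw α n A) := fun i => integrable_condSampleLaw_eval hllr i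
  -- with `f` the density of `π` and `c` the probability of the event, integrate `log y ≤ y - 1` at
  -- `y = c ∏ f (x_i)`, which is positive almost surely for the conditioned sample
  have hlog : ∫ x, (∑ i, Real.log (density α π (x i)) + Real.log c) ∂(condSampleLaw α n A) ≤
      ∫ x, (c * ∏ i, density α π (x i) - 1) ∂(condSampleLaw α n A) := by
    refine integral_mono_ae ((integrable_finsetSum _ fun i _ => hlogi i).add (integrable_const _))
      ((hprodQ.const_mul c).sub (integrable_const _)) ?_
    filter_upwards [hposQ] with x hx
    have hp : 0 < ∏ i, density α π (x i) := Finset.prod_pos fun i _ => hx i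
    rw [← Real.log_prod fun i _ => (hx i).ne', ← Real.log_mul hp.ne' hc0.ne', mul_comm]
    exact Real.log_le_sub_one_of_pos (mul_pos hc0 hp)
  rw [integral_add (integrable_finsetSum _ fun i _ => hlogi i) (integrable_const _),
    integral_finsetSum _ fun i _ => hlogi i, integral_sub (hprodQ.const_mul c) (integrable_const _),
    integral_const_mul] at hlog
  simp only [integral_condSampleLaw_eval (measurable_density α π).log, Finset.sum_const,
    Finset.card_univ, Fintype.card_fin, nsmul_eq_mul, integral_const, probReal_univ, smul_eq_mul,
    one_mul] at hlog
  have hklv : (klDiv (conditionalLaw α n A) α).toReal =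
      ∫ y, Real.log (density α π y) ∂(conditionalLaw α n A) :=
    toReal_klDiv_of_measure_eq hac (by
      rw [measure_univ, measure_univ])
  rw [hklv]
  linarith

end

/-! ### Exponential moments and the dual Orlicz norm -/

section

lemma exp_le_two_mul_tau_add_three (u : ℝ) : Real.exp |u| ≤ 2 * tau u + 3 := by
  have := Real.quadratic_le_exp_of_nonneg (abs_nonneg u)
  unfold tau
  nlinarith [sq_nonneg (|u| - 1)]

lemma exp_sub_one_sub_id_le (u : ℝ) : Real.exp u - 1 - u ≤ u ^ 2 * Real.exp |u| := by
  have h1 := Real.add_one_le_exp u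
  have h2 : Real.exp u * (1 - u) ≤ 1 := by
    have := mul_le_mul_of_nonneg_left (Real.one_sub_le_exp_neg u) (Real.exp_pos u).le
    rwa [← Real.exp_add, add_neg_cancel, Real.exp_zero] at this
  have h3 : 1 ≤ Real.exp |u| := Real.one_le_exp (abs_nonneg u)
  rcases le_total 0 u with hu | hu
  · rw [abs_of_nonneg hu] at h3 ⊢
    nlinarith [mul_nonneg hu (sub_nonneg.2 h1)]
  · nlinarith [mul_nonneg (neg_nonneg.2 hu) (sub_nonneg.2 h1),
      mul_nonneg (sq_nonneg u) (sub_nonneg.2 h3)]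

lemma exp_mul_le {r : ℝ} (hr : |r| ≤ 1 / 2) (y : ℝ) :
    Real.exp (r * y) ≤ 1 + r * y + 8 * r ^ 2 * Real.exp |y| := by
  have h1 := exp_sub_one_sub_id_le (r * y)
  have h2 : Real.exp |r * y| ≤ Real.exp (|y| / 2) := by
    rw [abs_mul]
    exact Real.exp_le_exp.2 (by nlinarith [abs_nonneg y])
  have h3 : y ^ 2 ≤ 8 * Real.exp (|y| / 2) := by
    have := Real.quadratic_le_exp_of_nonneg (x := |y| / 2) (by positivity)
    have := sq_abs y
    nlinarith [abs_nonneg y]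
  have h4 : (r * y) ^ 2 * Real.exp |r * y| ≤ 8 * r ^ 2 * Real.exp |y| := by
    calc (r * y) ^ 2 * Real.exp |r * y| ≤ (r * y) ^ 2 * Real.exp (|y| / 2) := by gcongr
      _ = r ^ 2 * (y ^ 2 * Real.exp (|y| / 2)) := by ring
      _ ≤ r ^ 2 * ((8 * Real.exp (|y| / 2)) * Real.exp (|y| / 2)) := by gcongr
      _ = 8 * r ^ 2 * (Real.exp (|y| / 2) * Real.exp (|y| / 2)) := by ring
      _ = 8 * r ^ 2 * Real.exp |y| := by rw [← Real.exp_add, add_halves]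
  linarith

variable {E : Type*} [MeasurableSpace E] {α : Measure E}

/-- A function in the unit ball of the Luxemburg norm has a uniformly bounded exponential moment.
The exponent `1 / 2` leaves room for the infimum in the norm not being attained. -/
lemma lintegral_exp_le_of_luxemburgNorm_le [IsProbabilityMeasure α] {g : E → ℝ}
    (h : luxemburgNorm α g ≤ 1) :
    ∫⁻ x, ENNReal.ofReal (Real.exp (|g x| / 2)) ∂α ≤ 5 := by
  have h2 : luxemburgNorm α g < 2 := h.trans_lt (by norm_num)
  simp only [luxemburgNorm, iInf_lt_iff] at h2
  obtain ⟨s, ⟨hs0, hs⟩, hs2⟩ := h2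
  have hs2' : (s : ℝ) ≤ 2 := by exact_mod_cast hs2.le
  have hs0' : (0 : ℝ) < s := hs0
  calc ∫⁻ x, ENNReal.ofReal (Real.exp (|g x| / 2)) ∂α
      ≤ ∫⁻ x, 2 * ENNReal.ofReal (tau (g x / s)) + 3 ∂α := by
        refine lintegral_mono fun x => ?_
        have h1 : Real.exp (|g x| / 2) ≤ Real.exp |g x / s| := by
          rw [abs_div, abs_of_pos hs0']
          exact Real.exp_le_exp.2 (by gcongr)
        have h3 : 0 ≤ tau (g x / s) := by
          have := Real.add_one_le_exp |g x / s|
          unfold tau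
          linarith
        calc ENNReal.ofReal (Real.exp (|g x| / 2))
            ≤ ENNReal.ofReal (2 * tau (g x / s) + 3) :=
              ENNReal.ofReal_le_ofReal (h1.trans (exp_le_two_mul_tau_add_three _))
          _ = 2 * ENNReal.ofReal (tau (g x / s)) + 3 := by
              rw [ENNReal.ofReal_add (by positivity) (by norm_num),
                ENNReal.ofReal_mul (by norm_num)]
              norm_num
    _ = 2 * ∫⁻ x, ENNReal.ofReal (tau (g x / s)) ∂α + 3 := by
        rw [lintegral_add_right _ measurable_const, lintegral_const_mul' _ _ (by norm_num)]
        simp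
    _ ≤ 2 * 1 + 3 := by gcongr
    _ = 5 := by norm_num

/-- Hölder's inequality transfers the exponential moment from `α` to a measure whose density is in
`L^p(α)`. -/
lemma lintegral_exp_le_of_eLpNorm_density_le [IsProbabilityMeasure α] {β : ProbabilityMeasure E}
    (hac : (β : Measure E) ≪ α) {p q : ℝ} (hpq : p.HolderConjugate q) {M : ℝ≥0}
    (hM : eLpNorm (density α β) (ENNReal.ofReal p) α ≤ M) {g : E → ℝ} (hg : Measurable g)
    (h : ∫⁻ x, ENNReal.ofReal (Real.exp (|g x| / 2)) ∂α ≤ 5) :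
    ∫⁻ x, ENNReal.ofReal (Real.exp (1 / (2 * q) * |g x|)) ∂(β : Measure E) ≤ M * 5 := by
  have hp0 := hpq.pos
  have hq0 := hpq.symm.pos
  have hmeas : Measurable fun x => ENNReal.ofReal (Real.exp (1 / (2 * q) * |g x|)) := by
    fun_prop
  have e1 : eLpNorm (density α β) (ENNReal.ofReal p) α =
      (∫⁻ x, ((β : Measure E).rnDeriv α x) ^ p ∂α) ^ (1 / p) := by
    rw [eLpNorm_eq_lintegral_rpow_enorm_toReal (by simpa using hp0) ENNReal.ofReal_ne_top,
      ENNReal.toReal_ofReal hp0.le]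
    congr 1
    refine lintegral_congr_ae ?_
    filter_upwards [(β : Measure E).rnDeriv_lt_top α] with x hx
    rw [density, Real.enorm_of_nonneg ENNReal.toReal_nonneg, ENNReal.ofReal_toReal hx.ne]
  have e2 : ∫⁻ x, ENNReal.ofReal (Real.exp (1 / (2 * q) * |g x|)) ^ q ∂α ≤ 5 := by
    refine (lintegral_mono fun x => ?_).trans h
    rw [ENNReal.ofReal_rpow_of_pos (Real.exp_pos _), ← Real.exp_mul]
    refine ENNReal.ofReal_le_ofReal (Real.exp_le_exp.2 (le_of_eq ?_))
    field_simp
  rw [← lintegral_rnDeriv_mul hac hmeas.aemeasurable]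
  refine (ENNReal.lintegral_mul_le_Lp_mul_Lq α hpq
    (Measure.measurable_rnDeriv _ _).aemeasurable hmeas.aemeasurable).trans ?_
  rw [← e1]
  refine mul_le_mul' hM ?_
  calc (∫⁻ x, ENNReal.ofReal (Real.exp (1 / (2 * q) * |g x|)) ^ q ∂α) ^ (1 / q)
      ≤ 5 ^ (1 / q) := ENNReal.rpow_le_rpow e2 (by positivity)
    _ ≤ 5 ^ (1 : ℝ) := ENNReal.rpow_le_rpow_of_exponent_le (by norm_num) (by
        rw [div_le_one hq0]; exact hpq.symm.lt.le)
    _ = 5 := by simp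

/-- The variational inequality extends from bounded functions to functions with an exponential
moment, by truncation. The integrability with respect to `γ` is part of the conclusion. -/
theorem VarEntropyLE.of_integrable_exp {γ β : Measure E} [IsProbabilityMeasure γ]
    [IsProbabilityMeasure β] {D : ℝ} (h : VarEntropyLE γ β D) {v : E → ℝ} (hv : Measurable v)
    (hexp : Integrable (fun x => Real.exp |v x|) β) :
    Integrable v γ ∧ ∫ x, v x ∂γ + 1 - ∫ x, Real.exp (v x) ∂β ≤ D := by
  have hint : Integrable v γ := by
    -- monotone convergence for the truncations of `|v|`
    let w : ℕ → E → ℝ := fun k x => min |v x| k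
    have hw : ∀ k, Measurable (w k) := fun k => by fun_prop
    have hw0 : ∀ k x, 0 ≤ w k x := fun k x => le_min (abs_nonneg _) (Nat.cast_nonneg k)
    have hwk : ∀ k x, |w k x| ≤ k := fun k x => by
      rw [abs_of_nonneg (hw0 k x)]; exact min_le_right _ _
    have hb : ∀ k, ∫⁻ x, ENNReal.ofReal (w k x) ∂γ ≤
        ENNReal.ofReal (D - 1 + ∫ x, Real.exp |v x| ∂β) := fun k => by
      rw [← ofReal_integral_eq_lintegral_ofReal (integrable_of_bdd γ (hw k) (hwk k))
        (Eventually.of_forall (hw0 k))]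
      refine ENNReal.ofReal_le_ofReal ?_
      have h1 := h (w k) (hw k) k (hwk k)
      have h2 : ∫ x, Real.exp (w k x) ∂β ≤ ∫ x, Real.exp |v x| ∂β :=
        integral_mono (integrable_of_bdd β (hw k).exp (abs_exp_le (hwk k))) hexp
          fun x => Real.exp_le_exp.2 (min_le_left _ _)
      linarith
    have hlim : Tendsto (fun k => ∫⁻ x, ENNReal.ofReal (w k x) ∂γ) atTop
        (𝓝 (∫⁻ x, ENNReal.ofReal |v x| ∂γ)) := by
      refine lintegral_tendsto_of_tendsto_of_monotone
        (fun k => (hw k).ennreal_ofReal.aemeasurable)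
        (Eventually.of_forall fun x k l hkl => ENNReal.ofReal_le_ofReal
          (min_le_min_left _ (Nat.cast_le.2 hkl)))
        (Eventually.of_forall fun x => ?_)
      refine tendsto_const_nhds.congr' ?_
      filter_upwards [tendsto_natCast_atTop_atTop.eventually_ge_atTop |v x|] with k hk
      simp only [w, min_eq_left hk]
    refine ⟨hv.aestronglyMeasurable, ?_⟩
    rw [hasFiniteIntegral_iff_norm]
    exact (le_of_tendsto' hlim hb).trans_lt ENNReal.ofReal_lt_top
  refine ⟨hint, ?_⟩
  -- dominated convergence for the truncations of `v`
  let v' : ℕ → E → ℝ := fun k x => max (-k) (min (v x) k)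
  have hv' : ∀ k, Measurable (v' k) := fun k => by fun_prop
  have hk : ∀ k x, |v' k x| ≤ k := fun k x => by
    have : (0 : ℝ) ≤ k := Nat.cast_nonneg k
    exact abs_le.2 ⟨le_max_left _ _, max_le (by linarith) (min_le_right _ _)⟩
  have hle : ∀ k x, |v' k x| ≤ |v x| := fun k x => by
    have h0 : (0 : ℝ) ≤ k := Nat.cast_nonneg k
    refine abs_le.2 ⟨?_, max_le ?_ ((min_le_left _ _).trans (le_abs_self _))⟩
    · rcases le_total (v x) k with hx | hx
      · simp only [v', min_eq_left hx]
        exact (neg_abs_le _).trans (le_max_right _ _)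
      · simp only [v', min_eq_right hx]
        exact (neg_nonpos.2 (abs_nonneg _)).trans (h0.trans (le_max_right _ _))
    · linarith [abs_nonneg (v x)]
  have hpt : ∀ x, Tendsto (fun k => v' k x) atTop (𝓝 (v x)) := fun x => by
    refine tendsto_const_nhds.congr' ?_
    filter_upwards [tendsto_natCast_atTop_atTop.eventually_ge_atTop |v x|] with k hk
    have := abs_le.1 hk
    simp only [v', min_eq_left this.2, max_eq_right this.1]
  have l1 : Tendsto (fun k => ∫ x, v' k x ∂γ) atTop (𝓝 (∫ x, v x ∂γ)) :=
    tendsto_integral_of_dominated_convergence (fun x => |v x|)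
      (fun k => (hv' k).aestronglyMeasurable) hint.abs
      (fun k => Eventually.of_forall (hle k)) (Eventually.of_forall hpt)
  have l2 : Tendsto (fun k => ∫ x, Real.exp (v' k x) ∂β) atTop (𝓝 (∫ x, Real.exp (v x) ∂β)) :=
    tendsto_integral_of_dominated_convergence (fun x => Real.exp |v x|)
      (fun k => (hv' k).exp.aestronglyMeasurable) hexp
      (fun k => Eventually.of_forall fun x => by
        rw [Real.norm_eq_abs, Real.abs_exp]
        exact Real.exp_le_exp.2 ((le_abs_self _).trans (hle k x)))
      (Eventually.of_forall fun x => (Real.continuous_exp.tendsto _).comp (hpt x))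
  exact le_of_tendsto' ((l1.add_const 1).sub l2) fun k => h _ (hv' k) k (hk k)

/-- Transport inequality: a small entropy `H(γ ∣ β)` forces the integrals of `g` for `γ` and `β` to
be close, as soon as `g` has an exponential moment for `β`. It is the variational inequality for
`± r θ g`, where `e ^ u ≤ 1 + u + O(r ^ 2)`. -/
theorem VarEntropyLE.abs_integral_sub_le {γ β : Measure E} [IsProbabilityMeasure γ]
    [IsProbabilityMeasure β] {D : ℝ} (h : VarEntropyLE γ β D) {g : E → ℝ} (hg : Measurable g)
    {θ K : ℝ} (hθ : 0 < θ) (hK : 0 ≤ K)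
    (hexp : ∫⁻ x, ENNReal.ofReal (Real.exp (θ * |g x|)) ∂β ≤ ENNReal.ofReal K)
    {r : ℝ} (hr0 : 0 < r) (hr : r ≤ 1 / 2) :
    Integrable g γ ∧ |∫ x, g x ∂γ - ∫ x, g x ∂β| ≤ (D + 8 * r ^ 2 * K) / (r * θ) := by
  have hmeas : Measurable fun x => Real.exp (θ * |g x|) := by fun_prop
  have hpos : ∀ x, 0 ≤ Real.exp (θ * |g x|) := fun x => (Real.exp_pos _).le
  have hi : Integrable (fun x => Real.exp (θ * |g x|)) β := by
    refine ⟨hmeas.aestronglyMeasurable, ?_⟩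
    rw [hasFiniteIntegral_iff_ofReal (Eventually.of_forall hpos)]
    exact hexp.trans_lt ENNReal.ofReal_lt_top
  have hiK : ∫ x, Real.exp (θ * |g x|) ∂β ≤ K := by
    rw [integral_eq_lintegral_of_nonneg_ae (Eventually.of_forall hpos) hmeas.aestronglyMeasurable]
    exact ENNReal.toReal_le_of_le_ofReal hK hexp
  have hgβ : Integrable g β := by
    refine (hi.const_mul θ⁻¹).mono' hg.aestronglyMeasurable (Eventually.of_forall fun x => ?_)
    rw [Real.norm_eq_abs, ← div_eq_inv_mul, le_div_iff₀ hθ]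
    linarith [Real.add_one_le_exp (θ * |g x|)]
  have key : ∀ ρ : ℝ, |ρ| ≤ 1 / 2 → Integrable (fun x => ρ * (θ * g x)) γ ∧
      ρ * θ * (∫ x, g x ∂γ - ∫ x, g x ∂β) ≤ D + 8 * ρ ^ 2 * K := by
    intro ρ hρ
    have habs : ∀ x, |ρ * (θ * g x)| ≤ θ * |g x| := fun x => by
      rw [abs_mul, abs_mul, abs_of_pos hθ]
      exact mul_le_of_le_one_left (by positivity) (hρ.trans (by norm_num))
    have hm : Measurable fun x => ρ * (θ * g x) := by fun_prop
    have hvi : Integrable (fun x => Real.exp |ρ * (θ * g x)|) β := by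
      refine hi.mono' hm.abs.exp.aestronglyMeasurable (Eventually.of_forall fun x => ?_)
      rw [Real.norm_eq_abs, Real.abs_exp]
      exact Real.exp_le_exp.2 (habs x)
    obtain ⟨i1, i2⟩ := h.of_integrable_exp hm hvi
    refine ⟨i1, ?_⟩
    have hv1 : Integrable (fun x => ρ * (θ * g x)) β := (hgβ.const_mul θ).const_mul ρ
    have i3 : ∫ x, Real.exp (ρ * (θ * g x)) ∂β ≤
        ∫ x, (1 + ρ * (θ * g x)) + 8 * ρ ^ 2 * Real.exp (θ * |g x|) ∂β := by
      refine integral_mono_of_nonneg (Eventually.of_forall fun x => (Real.exp_pos _).le)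
        (((integrable_const _).add hv1).add (hi.const_mul _)) (Eventually.of_forall fun x => ?_)
      have := exp_mul_le hρ (θ * g x)
      rwa [abs_mul, abs_of_pos hθ] at this
    have hv2 : Integrable (fun x => 1 + ρ * (θ * g x)) β := (integrable_const _).add hv1
    rw [integral_add hv2 (hi.const_mul _), integral_add (integrable_const _) hv1,
      integral_const_mul, integral_const_mul,
      integral_const_mul] at i3
    rw [integral_const_mul, integral_const_mul] at i2
    simp only [integral_const, probReal_univ, smul_eq_mul, mul_one] at i3
    have i4 : 8 * ρ ^ 2 * ∫ x, Real.exp (θ * |g x|) ∂β ≤ 8 * ρ ^ 2 * K := by gcongr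
    linarith
  obtain ⟨i1, k1⟩ := key r (by rwa [abs_of_pos hr0])
  obtain ⟨-, k2⟩ := key (-r) (by rwa [abs_neg, abs_of_pos hr0])
  have hrθ : 0 < r * θ := mul_pos hr0 hθ
  refine ⟨?_, ?_⟩
  · refine (i1.const_mul (r * θ)⁻¹).congr (Eventually.of_forall fun x => ?_)
    simp only
    field_simp
  · rw [le_div_iff₀ hrθ, ← abs_of_pos hrθ, ← abs_mul, abs_le]
    rw [neg_sq] at k2
    constructor <;> linarith

/-- The transport inequality, uniformly over the unit ball of `L_τ(α)`, for two measures `γ` and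
`γ'` having a small entropy with respect to the same `β`. -/
theorem dualNormSub_le [IsProbabilityMeasure α] {γ γ' β : ProbabilityMeasure E} {D D' : ℝ}
    (h : VarEntropyLE (γ : Measure E) (β : Measure E) D)
    (h' : VarEntropyLE (γ' : Measure E) (β : Measure E) D')
    (hac : (β : Measure E) ≪ α) {p q : ℝ} (hpq : p.HolderConjugate q) {M : ℝ≥0}
    (hM : eLpNorm (density α β) (ENNReal.ofReal p) α ≤ M) {r : ℝ} (hr0 : 0 < r) (hr : r ≤ 1 / 2) :
    dualNormSub α (γ : Measure E) (γ' : Measure E) ≤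
      ENNReal.ofReal ((D + D' + 80 * r ^ 2 * M) / (r * (1 / (2 * q)))) := by
  have hq0 := hpq.symm.pos
  refine iSup₂_le fun g hg => ?_
  have hexp := lintegral_exp_le_of_eLpNorm_density_le hac hpq hM hg.1.1
    (lintegral_exp_le_of_luxemburgNorm_le hg.2)
  have hM5 : (M : ℝ≥0∞) * 5 = ENNReal.ofReal (M * 5) := by
    rw [ENNReal.ofReal_mul (by positivity), ENNReal.ofReal_coe_nnreal]; norm_num
  rw [hM5] at hexp
  obtain ⟨i1, b1⟩ := h.abs_integral_sub_le hg.1.1 (by positivity) (by positivity) hexp hr0 hr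
  obtain ⟨i2, b2⟩ := h'.abs_integral_sub_le hg.1.1 (by positivity) (by positivity) hexp hr0 hr
  rw [if_pos ⟨i1, i2⟩]
  refine ENNReal.ofReal_le_ofReal ?_
  have e : (D + D' + 80 * r ^ 2 * M) / (r * (1 / (2 * q))) =
      (D + 8 * r ^ 2 * (M * 5)) / (r * (1 / (2 * q))) +
      (D' + 8 * r ^ 2 * (M * 5)) / (r * (1 / (2 * q))) := by ring
  rw [e]
  rw [abs_sub_comm] at b2
  exact (abs_sub_le _ _ _).trans (add_le_add b1 b2)

lemma neg_log_le_of_lt_log_div {n : ℕ+} {c : ℝ≥0∞} (hc : c ≤ 1) {b : ℝ}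
    (h : ((b : ℝ) : EReal) < ENNReal.log c / ((n : ℕ) : EReal)) :
    c ≠ 0 ∧ -Real.log c.toReal ≤ n * -b := by
  have hn : (0 : ℝ) < n := by exact_mod_cast n.pos
  have hn' : ((n : ℕ) : EReal) = ((n : ℝ) : EReal) := rfl
  have h0 : c ≠ 0 := by
    rintro rfl
    rw [ENNReal.log_zero, hn', EReal.bot_div_of_pos_ne_top (by exact_mod_cast hn)
      (EReal.coe_ne_top _)] at h
    exact not_lt_bot h
  refine ⟨h0, ?_⟩
  rw [ENNReal.log_pos_real h0 (hc.trans_lt ENNReal.one_lt_top).ne, hn', ← EReal.coe_div,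
    EReal.coe_lt_coe_iff, lt_div_iff₀ hn] at h
  linarith

end

end ThinSets

/-! ### Convergence in the dual norm -/

open ThinSets in
theorem proposition2p12 {E : Type*} [TopologicalSpace E] [PolishSpace E] [MeasurableSpace E]
    [BorelSpace E] (α : Measure E) [IsProbabilityMeasure α]
    -- the class of functions defining the `G`-topology
    (G : Set (E → ℝ)) (hGmeas : ∀ g ∈ G, Measurable g)
    (hGbdd : ∀ g : E → ℝ, Measurable g → (∃ c : ℝ, ∀ x, |g x| ≤ c) → g ∈ G)
    (hGint : ∀ g ∈ G, Integrable g α)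
    -- the non increasing sequence of constraints
    (C : ℕ+ → Set (ProbabilityMeasure E)) (hanti : Antitone C)
    (hconv : ∀ n, ThinSets.IsConvexSet (C n))
    (hclosed : ∀ n, ThinSets.IsGClosed G (C n))
    (hevent : ∀ n, NullMeasurableSet (ThinSets.empiricalEvent n (C n)) (ThinSets.sampleLaw α n))
    (hfin : ThinSets.entropyInf (⋂ n, C n) α < ∞)
    (αstar : ProbabilityMeasure E) (hproj : ThinSets.IsIProjection α (⋂ n, C n) αstar)
    (hlim : Tendsto (fun n => ThinSets.entropyInf (C n) α) atTop
      (𝓝 (ThinSets.entropyInf (⋂ n, C n) α)))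
    (hlower : -((ThinSets.entropyInf (⋂ n, C n) α : ℝ≥0∞) : EReal) ≤
      liminf (fun n : ℕ+ =>
        ENNReal.log (ThinSets.sampleLaw α n (ThinSets.empiricalEvent n (C n))) / ((n : ℕ) : EReal))
        atTop)
    -- the densities of the generalized `I`-projections are bounded in `L^p(α)`
    (p : ℝ) (hp : 1 < p)
    (hdensity : ∃ M : ℝ≥0, ∀ n, ∀ β : ProbabilityMeasure E,
      ThinSets.IsGenIProjection α (C n) β →
        eLpNorm (fun x => ((β : Measure E).rnDeriv α x).toReal) (ENNReal.ofReal p) α ≤ M) :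
    Tendsto
      (fun n => ThinSets.dualNormSub α (ThinSets.conditionalLaw α n (C n)) (αstar : Measure E))
      atTop (𝓝 0) := by
  obtain ⟨M, hM⟩ := hdensity
  set I := (entropyInf (⋂ n, C n) α).toReal with hI
  have hIconv : IsConvexSet (⋂ n, C n) := by
    rintro _ ⟨ν, hν, rfl⟩ _ ⟨γ, hγ, rfl⟩ a b ha hb hab
    choose η hη e using fun n => hconv n ⟨ν, Set.mem_iInter.1 hν n, rfl⟩
      ⟨γ, Set.mem_iInter.1 hγ n, rfl⟩ ha hb hab
    refine ⟨η 1, Set.mem_iInter.2 fun n => ?_, e 1⟩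
    have : η 1 = η n := Subtype.ext ((e 1).trans (e n).symm)
    rw [this]
    exact hη n
  have hsub : ∀ n, (⋂ n, C n) ⊆ C n := fun n => Set.iInter_subset C n
  have hfinn : ∀ n, entropyInf (C n) α < ∞ := fun n =>
    (biInf_mono (hsub n)).trans_lt hfin
  choose β hβ hβac _ using fun n => exists_isGenIProjection (hconv n) (hfinn n)
  have hlim' : Tendsto (fun n => (entropyInf (C n) α).toReal) atTop (𝓝 I) :=
    (ENNReal.tendsto_toReal hfin.ne).comp hlim
  have hpq := Real.HolderConjugate.conjExponent hp
  set q := p.conjExponent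
  have hq0 := hpq.symm.pos
  rw [ENNReal.tendsto_nhds_zero]
  intro ε hε
  obtain ⟨ε', hε'0, hε'ε⟩ : ∃ ε' : ℝ, 0 < ε' ∧ ENNReal.ofReal ε' ≤ ε := by
    rcases eq_or_ne ε ∞ with rfl | hε'
    · exact ⟨1, one_pos, le_top⟩
    · exact ⟨ε.toReal, ENNReal.toReal_pos hε.ne' hε', ENNReal.ofReal_toReal_le⟩
  set θ := 1 / (2 * q) with hθ
  have hθ0 : 0 < θ := by positivity
  -- `r` makes the quadratic term at most `ε' / 2`; the entropies are at most `2 δ` and `δ`, which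
  -- makes their contribution at most `ε' / 2`
  obtain ⟨r, hr0, hr, hrε⟩ : ∃ r : ℝ, 0 < r ∧ r ≤ 1 / 2 ∧ 80 * r * (M + 1) ≤ θ * ε' / 2 := by
    refine ⟨min (1 / 2) (θ * ε' / 2 / (80 * (M + 1))), lt_min (by norm_num) (by positivity),
      min_le_left _ _, ?_⟩
    have := (le_div_iff₀ (by positivity : (0 : ℝ) < 80 * (M + 1))).1
      (min_le_right (1 / 2) (θ * ε' / 2 / (80 * (M + 1))))
    linarith
  set δ := r * θ * ε' / 6 with hδ
  have hδ0 : 0 < δ := by positivity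
  have ev1 : ∀ᶠ n in atTop, I - δ < (entropyInf (C n) α).toReal :=
    hlim'.eventually_const_lt (by linarith)
  have ev2 : ∀ᶠ n : ℕ+ in atTop, ((-I - δ : ℝ) : EReal) <
      ENNReal.log (sampleLaw α n (empiricalEvent n (C n))) / ((n : ℕ) : EReal) := by
    refine eventually_lt_of_lt_liminf (lt_of_lt_of_le ?_ hlower)
    rw [← ENNReal.ofReal_toReal hfin.ne, ← hI, EReal.coe_ennreal_ofReal,
      max_eq_left ENNReal.toReal_nonneg, ← EReal.coe_neg, EReal.coe_lt_coe_iff]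
    linarith
  filter_upwards [ev1, ev2] with n h1 h2
  obtain ⟨hS, hlog⟩ := neg_log_le_of_lt_log_div prob_le_one h2
  obtain ⟨π, hπC, hπ⟩ := conditionalLaw_mem hGmeas hGint (hconv n) (hclosed n) (hevent n) hS
  obtain ⟨hkl, hklle⟩ := klDiv_conditionalLaw_le (α := α) (A := C n) hS
  rw [← hπ] at hkl hklle ⊢
  have hklI : (klDiv (π : Measure E) α).toReal ≤ I + δ := by
    have hn : (0 : ℝ) < n := by exact_mod_cast n.pos
    refine le_of_mul_le_mul_left (hklle.trans (hlog.trans_eq ?_)) hn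
    ring
  -- both the conditional law and `αstar` are close in entropy to the generalized
  -- `I`-projection `β n`
  have v1 := varEntropyLE_of_isGenIProjection (hconv n) (hβ n) hπC hkl
  have v2 := varEntropyLE_of_isGenIProjection_subset (hconv n) hIconv (hsub n) (hβ n) hproj.1
  refine (dualNormSub_le v1 v2 (hβac n) hpq (hM n _ (hβ n)) hr0 hr).trans
    ((ENNReal.ofReal_le_ofReal ?_).trans hε'ε)
  rw [← hθ, ← hI, div_le_iff₀ (by positivity)]
  have h3 : 80 * r ^ 2 * M ≤ r * (θ * ε' / 2) := by
    have hM0 : (0 : ℝ) ≤ M := M.2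
    nlinarith
  have h4 : 3 * δ = r * θ * ε' / 2 := by rw [hδ]; ring
  linarith
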